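/- Let $k\ge 1$ and $\alpha_1,\dots,\alpha_k,\beta_1,\dots,\beta_k,\eta_1,\dots,\eta_k\in\mathbb C$ be arbitrary, and extend the three sequences $k$-periodically to all indices $i\ge1$. Let $T(f)$ be the tridiagonal $k$-Toeplitz operator on $\ell^2(\mathbb N,\mathbb C)$, i.e. the bounded operator given by the semi-infinite matrix with diagonal entries $T_{i,i}=\alpha_i$, superdiagonal entries $T_{i,i+1}=\beta_i$, subdiagonal entries $T_{i+1,i}=\eta_i$, and all other entries $0$. Let $A_0\in\mathbb C^{k\times k}$ be the tridiagonal matrix with diagonal $\alpha_1,\dots,\alpha_k$, superdiagonal $\beta_1,\dots,\beta_{k-1}$ and subdiagonal $\eta_1,\dots,\eta_{k-1}$; let $A_{-1}$ have the single entry $\beta_k$ at position $(k,1)$, let $A_1$ have the single entry $\eta_k$ at position $(1,k)$, and let $$f(z)=A_{-1}z^{-1}+A_0+A_1z,\qquad z\in\mathbb T=\{z\in\mathbb C:|z|=1\},$$ be the symbol. Let $B_0$ be the leading $(k-1)\times(k-1)$ principal submatrix of $A_0$ (with $\sigma(B_0)=\emptyset$ if $k=1$). Put $$\sigma_{\det}(f)=\{\lambda\in\mathbb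 C:\ \det(f(z)-\lambda)=0\text{ for some }z\in\mathbb T\},$$ $$\sigma_{\mathrm{wind}}(f)=\{\lambda\in\mathbb C\setminus\sigma_{\det}(f):\ \operatorname{wind}(\det(f-\lambda),0)\ne0\},$$ where $\operatorname{wind}(g,p)=\frac1{2\pi i}\int_{g(\mathbb T)}\frac{d\xi}{\xi-p}$ and $g(\mathbb T)$ is traced as $\theta\mapsto g(e^{i\theta})$, $0\le\theta\le2\pi$. Then $$\sigma_{\det}(f)\cup\sigma_{\mathrm{wind}}(f)\subset\sigma(T(f))\subset\sigma_{\det}(f)\cup\sigma_{\mathrm{wind}}(f)\cup\sigma(B_0).$$ Moreover, whenever $\lambda_1,\dots,\lambda_k:[0,2\pi]\to\mathbb C$ are continuous and $\lambda_1(\theta),\dots,\lambda_k(\theta)$ are the eigenvalues of $f(e^{i\theta})$ with algebraic multiplicity for every $\theta$, one has $$\sigma_{\mathrm{wind}}(f)=\Big\{\lambda\in\mathbb C\setminus\sigma_{\det}(f):\ \sum_{j=1}^k\operatorname{wind}(\lambda_j,\lambda)\ne0\Big\},$$ where $\operatorname{wind}(\lambda_j,\lambda)=\frac{1}{2\pi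 i}\bigl(L_j(2\pi)-L_j(0)\bigr)$ for a continuous $L_j:[0,2\pi]\to\mathbb C$ with $e^{L_j}=\lambda_j-\lambda$ (a single $\lambda_j$ need not be closed; the sum is the total winding number of the closed curves obtained by concatenating the $\lambda_j$). -/

import Mathlib

noncomputable section

/-- The Hilbert space of square summable complex sequences `(x 0, x 1, x 2, …)`. -/
abbrev EllTwo : Type := lp (fun _ : ℕ => ℂ) 2

/-- The formal action on sequences of the semi-infinite tridiagonal matrix with diagonal
`α 0, α 1, …`, superdiagonal `β 0, β 1, …` and subdiagonal `η 0, η 1, …`, all three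
extended from `Fin k` to `ℕ` periodically with period `k` (`Fin.ofNat k n` is `n mod k`).
Rows and columns are numbered from `0`. -/
def kToeplitzAction (k : ℕ) [NeZero k] (α β η : Fin k → ℂ) (x : ℕ → ℂ) : ℕ → ℂ
  | 0 => α (Fin.ofNat k 0) * x 0 + β (Fin.ofNat k 0) * x 1
  | n + 1 => η (Fin.ofNat k n) * x n + α (Fin.ofNat k (n + 1)) * x (n + 1)
      + β (Fin.ofNat k (n + 1)) * x (n + 2)

/-- A square summable sequence multiplied by a periodic one is square summable. -/
theorem memℓp_periodic_mul (k : ℕ) [NeZero k] (c : Fin k → ℂ) (x : ℕ → ℂ)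
    (hx : Memℓp x 2) : Memℓp (fun n => c (Fin.ofNat k n) * x n) 2 := by
  have h2 : 0 < (2 : ENNReal).toReal := by norm_num
  rw [memℓp_gen_iff h2] at hx ⊢
  obtain ⟨C, hC⟩ := (Set.finite_range (fun i => ‖c i‖)).bddAbove
  refine Summable.of_nonneg_of_le (fun n => by positivity) (fun n => ?_)
    (hx.mul_left (C ^ (2 : ENNReal).toReal))
  rw [norm_mul, Real.mul_rpow (norm_nonneg _) (norm_nonneg _)]
  gcongr
  exact hC ⟨_, rfl⟩

theorem memℓp_shift_iff (x : ℕ → ℂ) : Memℓp (fun n => x (n + 1)) 2 ↔ Memℓp x 2 := by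
  have h2 : 0 < (2 : ENNReal).toReal := by norm_num
  rw [memℓp_gen_iff h2, memℓp_gen_iff h2]
  exact summable_nat_add_iff (f := fun n => ‖x n‖ ^ (2 : ENNReal).toReal) 1

theorem memℓp_kToeplitzAction (k : ℕ) [NeZero k] (α β η : Fin k → ℂ) (x : ℕ → ℂ)
    (hx : Memℓp x 2) : Memℓp (kToeplitzAction k α β η x) 2 := by
  rw [← memℓp_shift_iff]
  have h1 := memℓp_periodic_mul k η x hx
  have h2 := (memℓp_shift_iff _).2 (memℓp_periodic_mul k α x hx)
  have h3 := (memℓp_shift_iff _).2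
    (memℓp_periodic_mul k β (fun n => x (n + 1)) ((memℓp_shift_iff x).2 hx))
  exact (h1.add h2).add h3

/-- The tridiagonal `k`-Toeplitz operator with entries `α, β, η`, as a linear map on `ℓ²(ℕ)`. -/
def kToeplitzLinear (k : ℕ) [NeZero k] (α β η : Fin k → ℂ) : EllTwo →ₗ[ℂ] EllTwo where
  toFun x := ⟨kToeplitzAction k α β η x, memℓp_kToeplitzAction k α β η x (lp.memℓp x)⟩
  map_add' x y := by
    ext n
    change kToeplitzAction k α β η (x + y : EllTwo) n
      = kToeplitzAction k α β η x n + kToeplitzAction k α β η y n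
    cases n <;> simp [kToeplitzAction] <;> ring
  map_smul' c x := by
    ext n
    cases n <;> simp [kToeplitzAction] <;> ring

theorem kToeplitzLinear_apply (k : ℕ) [NeZero k] (α β η : Fin k → ℂ) (x : EllTwo) (n : ℕ) :
    kToeplitzLinear k α β η x n = kToeplitzAction k α β η x n := rfl

theorem continuous_kToeplitzLinear (k : ℕ) [NeZero k] (α β η : Fin k → ℂ) :
    Continuous (kToeplitzLinear k α β η) := by
  refine LinearMap.continuous_of_seq_closed_graph _ fun u x y hu hy => ?_
  have hc : ∀ (v : ℕ → EllTwo) (w : EllTwo), Filter.Tendsto v Filter.atTop (nhds w) →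
      ∀ n, Filter.Tendsto (fun m => v m n) Filter.atTop (nhds (w n)) := fun v w h n =>
    ((lp.evalCLM ℂ (fun _ : ℕ => ℂ) 2 n).continuous.tendsto w).comp h
  ext n
  refine tendsto_nhds_unique (hc _ _ hy n) ?_
  simp only [Function.comp_apply, kToeplitzLinear_apply]
  cases n with
  | zero =>
    exact ((hc u x hu 0).const_mul _).add ((hc u x hu 1).const_mul _)
  | succ n =>
    exact (((hc u x hu n).const_mul _).add ((hc u x hu (n + 1)).const_mul _)).add
      ((hc u x hu (n + 2)).const_mul _)

/-- The tridiagonal `k`-Toeplitz operator `T(f)`, a bounded operator on `ℓ²(ℕ)`. -/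
def kToeplitz (k : ℕ) [NeZero k] (α β η : Fin k → ℂ) : EllTwo →L[ℂ] EllTwo :=
  ⟨kToeplitzLinear k α β η, continuous_kToeplitzLinear k α β η⟩

/-- The diagonal block `A₀`. -/
def blockZero (k : ℕ) (α β η : Fin k → ℂ) : Matrix (Fin k) (Fin k) ℂ :=
  Matrix.of fun i j =>
    if j = i then α i
    else if (j : ℕ) = (i : ℕ) + 1 then β i
    else if (i : ℕ) = (j : ℕ) + 1 then η j
    else 0

/-- The superdiagonal block `A₋₁`: the last `β` in the lower left corner. -/
def blockSuper (k : ℕ) (β : Fin k → ℂ) : Matrix (Fin k) (Fin k) ℂ :=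
  Matrix.of fun i j => if (i : ℕ) + 1 = k ∧ (j : ℕ) = 0 then β i else 0

/-- The subdiagonal block `A₁`: the last `η` in the upper right corner. -/
def blockSub (k : ℕ) (η : Fin k → ℂ) : Matrix (Fin k) (Fin k) ℂ :=
  Matrix.of fun i j => if (i : ℕ) = 0 ∧ (j : ℕ) + 1 = k then η j else 0

/-- The symbol `f(z) = A₋₁ z⁻¹ + A₀ + A₁ z`; only its values on the unit circle are used. -/
def kToeplitzSymbol (k : ℕ) (α β η : Fin k → ℂ) (z : ℂ) : Matrix (Fin k) (Fin k) ℂ :=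
  z⁻¹ • blockSuper k β + blockZero k α β η + z • blockSub k η

/-- The leading `(k-1) × (k-1)` principal block `B₀` of `A₀`. -/
def leadingBlock (k : ℕ) (α β η : Fin k → ℂ) : Matrix (Fin (k - 1)) (Fin (k - 1)) ℂ :=
  (blockZero k α β η).submatrix (Fin.castLE (Nat.sub_le k 1)) (Fin.castLE (Nat.sub_le k 1))

/-- The winding number about `p` of the closed curve `g(𝕋)`, traced as
`θ ↦ g(e^{iθ})`, `0 ≤ θ ≤ 2π`, as the integral `(2πi)⁻¹ ∫ (ξ - p)⁻¹ dξ` along that curve.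
(It is used for `g` smooth along the circle and not taking the value `p` there.) -/
def wind (g : ℂ → ℂ) (p : ℂ) : ℂ :=
  (2 * Real.pi * Complex.I)⁻¹ *
    ∫ θ in (0 : ℝ)..(2 * Real.pi),
      (g (circleMap 0 1 θ) - p)⁻¹ * deriv (fun t : ℝ => g (circleMap 0 1 t)) θ

/-- `σ_det(f)`: all `lam` with `det (f(z) - lam) = 0` for some `z` on the unit circle. -/
def sigmaDet {k : ℕ} (f : ℂ → Matrix (Fin k) (Fin k) ℂ) : Set ℂ :=
  {lam | ∃ z : ℂ, ‖z‖ = 1 ∧ (f z - lam • (1 : Matrix (Fin k) (Fin k) ℂ)).det = 0}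

/-- `σ_wind(f)`: all `lam` outside `σ_det(f)` for which `det (f - lam)` has nonzero winding
number about `0`. -/
def sigmaWind {k : ℕ} (f : ℂ → Matrix (Fin k) (Fin k) ℂ) : Set ℂ :=
  {lam | lam ∉ sigmaDet f ∧
    wind (fun z => (f z - lam • (1 : Matrix (Fin k) (Fin k) ℂ)).det) 0 ≠ 0}

/-- `ev 0, …, ev (k-1)` are continuous traces of the eigenvalues of `f(e^{iθ})`,
`0 ≤ θ ≤ 2π`, counted with algebraic multiplicity. A single trace need not be closed. -/
def IsEigenvalueTraces {k : ℕ} (f : ℂ → Matrix (Fin k) (Fin k) ℂ) (ev : Fin k → ℝ → ℂ) : Prop :=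
  (∀ j, ContinuousOn (ev j) (Set.Icc 0 (2 * Real.pi))) ∧
  ∀ θ ∈ Set.Icc (0 : ℝ) (2 * Real.pi),
    (f (circleMap 0 1 θ)).charpoly = ∏ j, (Polynomial.X - Polynomial.C (ev j θ))

/-- The path `γ` on `[0, 2π]` avoids `p` and `w` is its index `(2πi)⁻¹ ∫_γ (ξ - p)⁻¹ dξ`,
expressed for a merely continuous path as `(2πi)⁻¹` times the increment of a continuous
logarithm of `γ - p`. For a closed path this is the winding number about `p`, and the index of
a concatenation of paths is the sum of their indices. -/
def HasPathIndex (γ : ℝ → ℂ) (p w : ℂ) : Prop :=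
  ∃ L : ℝ → ℂ, ContinuousOn L (Set.Icc 0 (2 * Real.pi)) ∧
    (∀ θ ∈ Set.Icc (0 : ℝ) (2 * Real.pi), Complex.exp (L θ) = γ θ - p) ∧
    w = (2 * Real.pi * Complex.I)⁻¹ * (L (2 * Real.pi) - L 0)

/-- `σ_wind(f)` in terms of eigenvalue traces: all `lam` outside `σ_det(f)` about which the
traces have nonzero total winding number. -/
def sigmaWindTraces {k : ℕ} (f : ℂ → Matrix (Fin k) (Fin k) ℂ) (ev : Fin k → ℝ → ℂ) : Set ℂ :=
  {lam | lam ∉ sigmaDet f ∧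
    ∃ w : Fin k → ℂ, (∀ j, HasPathIndex (ev j) lam (w j)) ∧ ∑ j, w j ≠ 0}

end

/-!
The spectrum of a tridiagonal `k`-Toeplitz operator is compared with the curve `det (f - λ)`.
Replacing `α` by `α - λ` moves the spectral parameter to `λ = 0`.

Outside `σ(B₀)` everything reduces to a scalar problem. Splitting a sequence into its residue
classes mod `k` (`blockEquiv`) turns `T(f)` into `A₋₁ B + A₀ + A₁ S`, acting on `k`-tuples
of `ℓ²` sequences, where `B` and `S` are the backward and forward shifts. Only the last row of
`A₋₁` and the last column of `A₁` are nonzero, so the elimination of the first `k - 1` residue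
classes inverts just the scalar matrix `B₀`, and since `B S = 1` the Schur complement is again of
the form `a B + b + c S`. The same computation with `z⁻¹` and `z` in place of `B` and `S` gives
`det f(z) = a z⁻¹ + b + c z` after multiplication by `det B₀` (`exists_scalar_toeplitz`).
This trinomial is `z⁻¹` times a product of two linear forms, neither of which has a zero on the
unit circle; according to the position of the zeros, `a B + b + c S` is a product of
invertible operators, possibly with one extra shift. The winding number is zero exactly if
there is no extra shift (`isUnit_trinomial_iff`). Hence outside `σ_det ∪ σ(B₀)` the spectrum is
`σ_wind` (`mem_spectrum_kToeplitz_iff`), which gives the upper bound for the spectrum.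

For the lower bound, `σ_det` lies in the spectrum because geometric sequences with ratio tending
to the unit circle are approximate eigenvectors (`not_bijective_blockToeplitz`). A point of
`σ_wind` that lies in `σ(B₀)` is a limit of points of `σ_wind` outside the finite set `σ(B₀)`,
because the winding number is locally constant (`wind_eq_of_norm_sub_lt`), and the spectrum is
closed.

The winding number is the increment of any continuous logarithm (`wind_eq_of_exp_eq`). For
eigenvalue traces the logarithms of `ev j - λ` add up to a logarithm of `det (f - λ)`, which gives
the description of `σ_wind` by traces.
-/

/-! ### Logarithms along a path and winding numbers -/

/-- Existence of a continuous logarithm along a path avoiding `0`. -/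
theorem exists_continuousOn_log {a b : ℝ} (hab : a < b) {h : ℝ → ℂ}
    (hc : ContinuousOn h (Set.Icc a b)) (h0 : ∀ t ∈ Set.Icc a b, h t ≠ 0) :
    ∃ L : ℝ → ℂ, ContinuousOn L (Set.Icc a b) ∧ ∀ t ∈ Set.Icc a b, Complex.exp (L t) = h t := by
  have hmaps : ∀ s : unitInterval, ((iccHomeoI a b hab).symm s : ℝ) ∈ Set.Icc a b :=
    fun s => ((iccHomeoI a b hab).symm s).2
  let γ : C(unitInterval, {z : ℂ // z ≠ 0}) :=
    ⟨fun s => ⟨h ((iccHomeoI a b hab).symm s), h0 _ (hmaps s)⟩, by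
      refine Continuous.subtype_mk ?_ _
      exact hc.comp_continuous (by fun_prop) hmaps⟩
  obtain ⟨Γ, hΓ, -⟩ := Complex.isCoveringMap_exp.exists_path_lifts γ (Complex.log (γ 0))
    (Subtype.ext (Complex.exp_log (γ 0).2).symm)
  refine ⟨Set.IccExtend hab.le (fun t => Γ (iccHomeoI a b hab t)), ?_, fun t ht => ?_⟩
  · exact (Continuous.Icc_extend' (by fun_prop)).continuousOn
  · rw [Set.IccExtend_of_mem _ _ ht]
    have := congrArg Subtype.val (congrFun hΓ (iccHomeoI a b hab ⟨t, ht⟩))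
    simpa only [γ, Function.comp_apply, ContinuousMap.coe_mk, Homeomorph.symm_apply_apply] using this

/-- A continuous logarithm of a differentiable path is differentiable. -/
theorem hasDerivAt_of_exp_eq {L h : ℝ → ℂ} {t : ℝ} {h' : ℂ} (hL : ContinuousAt L t)
    (he : ∀ᶠ s in nhds t, Complex.exp (L s) = h s) (hd : HasDerivAt h h' t) :
    HasDerivAt L (h' / h t) t := by
  have ht : Complex.exp (L t) = h t := he.self_of_nhds
  have hne : h t ≠ 0 := ht ▸ Complex.exp_ne_zero _
  -- near `t` the path `L` is `L t` plus the principal logarithm of `h s / h t`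
  have h1 : HasDerivAt (fun s => L t + Complex.log (h s / h t)) (h' / h t) t := by
    have := ((hd.div_const (h t)).clog_real (by simp [div_self hne])).const_add (L t)
    simpa [div_self hne] using this
  refine h1.congr_of_eventuallyEq ?_
  have h2 : ∀ᶠ s in nhds t, L s ∈ Metric.ball (L t) Real.pi :=
    hL (Metric.ball_mem_nhds _ Real.pi_pos)
  filter_upwards [h2, he] with s hs hes
  have him : |(L s - L t).im| < Real.pi :=
    (Complex.abs_im_le_norm _).trans_lt (by simpa [dist_eq_norm] using hs)
  rw [← hes, ← ht, ← Complex.exp_sub, Complex.log_exp (abs_lt.1 him).1 (abs_lt.1 him).2.le]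
  ring

/-- The winding number as the increment of an arbitrary continuous logarithm. -/
theorem wind_eq_of_exp_eq {g : ℂ → ℂ} {p : ℂ} {L : ℝ → ℂ}
    (hg : ContDiff ℝ 1 fun t : ℝ => g (circleMap 0 1 t))
    (hL : ContinuousOn L (Set.Icc 0 (2 * Real.pi)))
    (he : ∀ θ ∈ Set.Icc (0 : ℝ) (2 * Real.pi), Complex.exp (L θ) = g (circleMap 0 1 θ) - p) :
    wind g p = (2 * Real.pi * Complex.I)⁻¹ * (L (2 * Real.pi) - L 0) := by
  unfold wind
  congr 1
  have h2 : (0 : ℝ) ≤ 2 * Real.pi := by positivity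
  have hd : Differentiable ℝ fun t : ℝ => g (circleMap 0 1 t) := hg.differentiable one_ne_zero
  refine intervalIntegral.integral_eq_sub_of_hasDerivAt_of_le h2 hL (fun θ hθ => ?_) ?_
  · have hn := Icc_mem_nhds hθ.1 hθ.2
    have := hasDerivAt_of_exp_eq (hL.continuousAt hn) (Filter.eventually_of_mem hn he)
      ((hd θ).hasDerivAt.sub_const p)
    rwa [div_eq_inv_mul] at this
  · refine ContinuousOn.intervalIntegrable_of_Icc h2 (ContinuousOn.mul ?_ ?_)
    · refine ContinuousOn.inv₀ (by exact (hd.continuous.sub continuous_const).continuousOn) ?_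
      intro θ hθ
      rw [← he θ hθ]
      exact Complex.exp_ne_zero _
    · exact (hg.continuous_deriv le_rfl).continuousOn

theorem circleMap_two_pi : circleMap 0 1 (2 * Real.pi) = circleMap 0 1 0 := by
  simpa using periodic_circleMap 0 1 0

/-- Rouché's theorem for winding numbers of smooth closed curves. -/
theorem wind_eq_of_norm_sub_lt {g₀ g₁ : ℂ → ℂ}
    (h₀ : ContDiff ℝ 1 fun t : ℝ => g₀ (circleMap 0 1 t))
    (h₁ : ContDiff ℝ 1 fun t : ℝ => g₁ (circleMap 0 1 t))
    (hlt : ∀ θ ∈ Set.Icc (0 : ℝ) (2 * Real.pi),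
      ‖g₁ (circleMap 0 1 θ) - g₀ (circleMap 0 1 θ)‖ < ‖g₀ (circleMap 0 1 θ)‖) :
    wind g₁ 0 = wind g₀ 0 := by
  have hne : ∀ θ ∈ Set.Icc (0 : ℝ) (2 * Real.pi), g₀ (circleMap 0 1 θ) ≠ 0 := fun θ hθ =>
    norm_pos_iff.1 ((norm_nonneg _).trans_lt (hlt θ hθ))
  obtain ⟨L, hLc, hL⟩ := exists_continuousOn_log (by positivity) h₀.continuous.continuousOn hne
  have hslit : ∀ θ ∈ Set.Icc (0 : ℝ) (2 * Real.pi),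
      g₁ (circleMap 0 1 θ) / g₀ (circleMap 0 1 θ) ∈ Complex.slitPlane := fun θ hθ => by
    refine Complex.ball_one_subset_slitPlane ?_
    have hpos := norm_pos_iff.2 (hne θ hθ)
    rw [mem_ball_iff_norm, div_sub_one (hne θ hθ), norm_div, div_lt_one hpos]
    exact hlt θ hθ
  rw [wind_eq_of_exp_eq h₀ hLc fun θ hθ => by rw [hL θ hθ, sub_zero],
    wind_eq_of_exp_eq (L := fun θ => L θ
      + Complex.log (g₁ (circleMap 0 1 θ) / g₀ (circleMap 0 1 θ))) h₁]
  · -- the correction term is a closed curve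
    rw [circleMap_two_pi]
    ring
  · exact hLc.add (ContinuousOn.clog
      (h₁.continuous.continuousOn.div h₀.continuous.continuousOn hne) hslit)
  · intro θ hθ
    rw [Complex.exp_add, hL θ hθ, Complex.exp_log (Complex.slitPlane_ne_zero (hslit θ hθ)),
      mul_div_cancel₀ _ (hne θ hθ), sub_zero]

/-! ### Scalar tridiagonal Toeplitz operators -/

/-- The backward shift `(x₀, x₁, …) ↦ (x₁, x₂, …)` on `ℓ²(ℕ)`. -/
def bwdShift : EllTwo →L[ℂ] EllTwo := kToeplitz 1 0 1 0

/-- The forward shift `(x₀, x₁, …) ↦ (0, x₀, x₁, …)` on `ℓ²(ℕ)`. -/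
def fwdShift : EllTwo →L[ℂ] EllTwo := kToeplitz 1 0 0 1

theorem kToeplitz_apply (k : ℕ) [NeZero k] (α β η : Fin k → ℂ) (x : EllTwo) (n : ℕ) :
    kToeplitz k α β η x n = kToeplitzAction k α β η x n := rfl

@[simp]
theorem bwdShift_apply (x : EllTwo) (n : ℕ) : bwdShift x n = x (n + 1) := by
  cases n <;> simp [bwdShift, kToeplitz_apply, kToeplitzAction]

@[simp]
theorem fwdShift_apply_zero (x : EllTwo) : fwdShift x 0 = 0 := by
  simp [fwdShift, kToeplitz_apply, kToeplitzAction]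

@[simp]
theorem fwdShift_apply_succ (x : EllTwo) (n : ℕ) : fwdShift x (n + 1) = x n := by
  simp [fwdShift, kToeplitz_apply, kToeplitzAction]

theorem bwdShift_mul_fwdShift : bwdShift * fwdShift = 1 := by
  ext x n
  simp

theorem bwdShift_fwdShift_apply (x : EllTwo) : bwdShift (fwdShift x) = x :=
  congrArg (fun A : EllTwo →L[ℂ] EllTwo => A x) bwdShift_mul_fwdShift

theorem EllTwo.norm_sq_eq_tsum (x : EllTwo) : ‖x‖ ^ 2 = ∑' n, ‖x n‖ ^ 2 := by
  simpa using lp.norm_rpow_eq_tsum (by norm_num : 0 < (2 : ENNReal).toReal) x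

theorem EllTwo.summable_norm_sq (x : EllTwo) : Summable fun n => ‖x n‖ ^ 2 := by
  simpa using (memℓp_gen_iff (by norm_num : 0 < (2 : ENNReal).toReal)).1 (lp.memℓp x)

theorem norm_fwdShift_apply (x : EllTwo) : ‖fwdShift x‖ = ‖x‖ := by
  refine (sq_eq_sq₀ (norm_nonneg _) (norm_nonneg _)).1 ?_
  rw [EllTwo.norm_sq_eq_tsum, EllTwo.norm_sq_eq_tsum,
    (EllTwo.summable_norm_sq _).tsum_eq_zero_add]
  simp

theorem norm_bwdShift_apply_le (x : EllTwo) : ‖bwdShift x‖ ≤ ‖x‖ := by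
  refine (sq_le_sq₀ (norm_nonneg _) (norm_nonneg _)).1 ?_
  rw [EllTwo.norm_sq_eq_tsum, EllTwo.norm_sq_eq_tsum x,
    (EllTwo.summable_norm_sq x).tsum_eq_zero_add]
  simp

theorem norm_fwdShift_le : ‖fwdShift‖ ≤ 1 :=
  ContinuousLinearMap.opNorm_le_bound _ zero_le_one fun x => by rw [norm_fwdShift_apply, one_mul]

theorem norm_bwdShift_le : ‖bwdShift‖ ≤ 1 :=
  ContinuousLinearMap.opNorm_le_bound _ zero_le_one fun x => by
    rw [one_mul]; exact norm_bwdShift_apply_le x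

theorem not_injective_bwdShift : ¬ Function.Injective bwdShift := fun h => by
  have h1 : bwdShift (lp.single 2 0 1) = bwdShift 0 := by
    ext n
    simp [lp.single_apply]
  have := congrArg (fun x : EllTwo => x 0) (h h1)
  simp at this

theorem not_surjective_fwdShift : ¬ Function.Surjective fwdShift := fun h => by
  obtain ⟨x, hx⟩ := h (lp.single 2 0 1)
  have := congrArg (fun x : EllTwo => x 0) hx
  simp at this

/-- A small perturbation of a scalar is invertible (Neumann series). -/
theorem isUnit_smul_one_add_smul {A : Type*} [NormedRing A] [NormedAlgebra ℂ A] [CompleteSpace A]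
    {S : A} (hS : ‖S‖ ≤ 1) {u v : ℂ} (h : ‖v‖ < ‖u‖) : IsUnit (u • (1 : A) + v • S) := by
  have hu : u ≠ 0 := norm_pos_iff.1 ((norm_nonneg _).trans_lt h)
  have h1 : ‖-((u⁻¹ * v) • S)‖ < 1 := by
    rw [norm_neg, norm_smul, norm_mul, norm_inv, ← div_eq_inv_mul]
    exact (mul_le_of_le_one_right (by positivity) hS).trans_lt
      ((div_lt_one (norm_pos_iff.2 hu)).2 h)
  have h2 := (isUnit_one_sub_of_norm_lt_one h1).smul (Units.mk0 u hu)
  convert h2 using 1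
  rw [Units.smul_mk0, sub_neg_eq_add, smul_add, smul_smul, mul_inv_cancel_left₀ hu]

/-- A binary quadratic form over `ℂ` is a product of linear forms. -/
theorem exists_linear_factors (a b c : ℂ) :
    ∃ u₁ v₁ u₂ v₂ : ℂ, a = u₁ * u₂ ∧ b = u₁ * v₂ + v₁ * u₂ ∧ c = v₁ * v₂ := by
  by_cases hc : c = 0
  · exact ⟨a, b, 1, 0, by simp, by simp, by simp [hc]⟩
  · obtain ⟨s, hs⟩ := IsAlgClosed.exists_eq_mul_self (discrim c b a)
    obtain ⟨r, hr⟩ := exists_quadratic_eq_zero hc ⟨s, hs⟩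
    exact ⟨-r, 1, b + c * r, c, by linear_combination hr, by ring, by ring⟩

/-- A linear form with no zero on the unit circle has coefficients of different modulus. -/
theorem norm_ne_norm_of_ne_zero {u v : ℂ} (h : ∀ z : ℂ, ‖z‖ = 1 → u + v * z ≠ 0) : ‖u‖ ≠ ‖v‖ := by
  intro he
  by_cases hv : v = 0
  · have hu : u = 0 := by simpa [hv] using he
    exact h 1 (by simp) (by simp [hu, hv])
  · refine h (-u / v) ?_ ?_
    · rw [norm_div, norm_neg, he, div_self (norm_ne_zero_iff.2 hv)]
    · field_simp; ring

/-- The closed path `u + v e(θ)` with `|v| < |u|` and `|e| = 1` has a closed logarithm. -/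
theorem exists_closed_log {e : ℝ → ℂ} (he : Continuous e) (h1 : ∀ θ, ‖e θ‖ = 1)
    (hper : e (2 * Real.pi) = e 0) {u v : ℂ} (h : ‖v‖ < ‖u‖) :
    ∃ L : ℝ → ℂ, Continuous L ∧ (∀ θ, Complex.exp (L θ) = u + v * e θ) ∧
      L (2 * Real.pi) = L 0 := by
  have hu : u ≠ 0 := norm_pos_iff.1 ((norm_nonneg _).trans_lt h)
  have hs : ∀ θ, 1 + v / u * e θ ∈ Complex.slitPlane := fun θ => by
    refine Complex.ball_one_subset_slitPlane ?_
    rw [mem_ball_iff_norm, add_sub_cancel_left, norm_mul, h1, mul_one, norm_div]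
    exact (div_lt_one (norm_pos_iff.2 hu)).2 h
  refine ⟨fun θ => Complex.log u + Complex.log (1 + v / u * e θ), ?_, fun θ => ?_, ?_⟩
  · exact continuous_const.add (Continuous.clog (by fun_prop) hs)
  · rw [Complex.exp_add, Complex.exp_log hu, Complex.exp_log (Complex.slitPlane_ne_zero (hs θ))]
    field_simp
  · simp only [hper]

theorem contDiff_inv_circleMap : ContDiff ℝ 1 fun t : ℝ => (circleMap 0 1 t)⁻¹ :=
  (contDiff_circleMap 0 1).inv fun _ => circleMap_ne_center one_ne_zero

theorem contDiff_trinomial (a b c : ℂ) :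
    ContDiff ℝ 1 fun t : ℝ => a * (circleMap 0 1 t)⁻¹ + b + c * circleMap 0 1 t :=
  ((contDiff_const.mul contDiff_inv_circleMap).add contDiff_const).add
    (contDiff_const.mul (contDiff_circleMap 0 1))

theorem norm_circleMap_one (θ : ℝ) : ‖circleMap 0 1 θ‖ = 1 := by simp

/-- A trinomial that is `z ^ n` times a function with a closed logarithm has winding
number `n`. -/
theorem wind_trinomial_eq {a b c : ℂ} (n : ℤ) {L₁ L₂ : ℝ → ℂ} (h₁ : Continuous L₁)
    (h₂ : Continuous L₂) (c₁ : L₁ (2 * Real.pi) = L₁ 0) (c₂ : L₂ (2 * Real.pi) = L₂ 0)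
    (h : ∀ θ, circleMap 0 1 θ ^ n * Complex.exp (L₁ θ) * Complex.exp (L₂ θ)
      = a * (circleMap 0 1 θ)⁻¹ + b + c * circleMap 0 1 θ) :
    wind (fun z => a * z⁻¹ + b + c * z) 0 = n := by
  rw [wind_eq_of_exp_eq (L := fun θ => n * (θ * Complex.I) + L₁ θ + L₂ θ)
    (contDiff_trinomial a b c) (by fun_prop), c₁, c₂]
  · have := Complex.two_pi_I_ne_zero
    push_cast
    field_simp
    ring
  · intro θ _
    rw [sub_zero, ← h, Complex.exp_add, Complex.exp_add, Complex.exp_int_mul]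
    simp [circleMap]

/-- A scalar tridiagonal Toeplitz operator whose symbol has no zero on the unit circle is
invertible exactly if the winding number of the symbol vanishes. The symbol is
`z⁻¹ (u₁ + v₁ z) (u₂ + v₂ z)`, and each linear factor is either `u` plus a smaller multiple
of `z` or `z` times (`v` plus a smaller multiple of `z⁻¹`); accordingly the operator is a product
of invertible factors with an additional backward shift, an additional forward shift, or
neither. -/
theorem isUnit_trinomial_iff {a b c : ℂ} (h : ∀ z : ℂ, ‖z‖ = 1 → a * z⁻¹ + b + c * z ≠ 0) :
    IsUnit (a • bwdShift + b • (1 : EllTwo →L[ℂ] EllTwo) + c • fwdShift) ↔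
      wind (fun z => a * z⁻¹ + b + c * z) 0 = 0 := by
  obtain ⟨u₁, v₁, u₂, v₂, rfl, rfl, rfl⟩ := exists_linear_factors a b c
  have hz0 : ∀ z : ℂ, ‖z‖ = 1 → z ≠ 0 := fun z hz => norm_pos_iff.1 (hz ▸ zero_lt_one)
  have hfac : ∀ z : ℂ, ‖z‖ = 1 → u₁ * u₂ * z⁻¹ + (u₁ * v₂ + v₁ * u₂) + v₁ * v₂ * z
      = z⁻¹ * (u₁ + v₁ * z) * (u₂ + v₂ * z) := fun z hz => by
    have := hz0 z hz
    field_simp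
    ring
  have hn₁ : ‖u₁‖ ≠ ‖v₁‖ :=
    norm_ne_norm_of_ne_zero fun z hz h0 => h z hz (by rw [hfac z hz, h0]; ring)
  have hn₂ : ‖u₂‖ ≠ ‖v₂‖ :=
    norm_ne_norm_of_ne_zero fun z hz h0 => h z hz (by rw [hfac z hz, h0]; ring)
  have hc0 : ∀ θ : ℝ, circleMap 0 1 θ ≠ 0 := fun θ => hz0 _ (norm_circleMap_one θ)
  have hce : Continuous (circleMap 0 1) := continuous_circleMap 0 1
  have hci : Continuous fun θ : ℝ => (circleMap 0 1 θ)⁻¹ := contDiff_inv_circleMap.continuous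
  have hni : ∀ θ : ℝ, ‖(circleMap 0 1 θ)⁻¹‖ = 1 := fun θ => by
    rw [norm_inv, norm_circleMap_one, inv_one]
  have hpi : (circleMap 0 1 (2 * Real.pi))⁻¹ = (circleMap 0 1 0)⁻¹ := by rw [circleMap_two_pi]
  -- the case of one linear factor of each kind
  have mixed : ∀ u₁ v₁ u₂ v₂ : ℂ, ‖u₁‖ < ‖v₁‖ → ‖v₂‖ < ‖u₂‖ →
      IsUnit ((u₁ * u₂) • bwdShift + (u₁ * v₂ + v₁ * u₂) • (1 : EllTwo →L[ℂ] EllTwo)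
          + (v₁ * v₂) • fwdShift) ∧
        wind (fun z => u₁ * u₂ * z⁻¹ + (u₁ * v₂ + v₁ * u₂) + v₁ * v₂ * z) 0 = 0 := by
    intro u₁ v₁ u₂ v₂ h₁ h₂
    constructor
    · convert (isUnit_smul_one_add_smul norm_bwdShift_le h₁).mul
        (isUnit_smul_one_add_smul norm_fwdShift_le h₂) using 1
      refine ContinuousLinearMap.ext fun x => ?_
      simp [bwdShift_fwdShift_apply]
      module
    · obtain ⟨L₁, hL₁, he₁, hp₁⟩ := exists_closed_log hci hni hpi h₁
      obtain ⟨L₂, hL₂, he₂, hp₂⟩ :=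
        exists_closed_log hce norm_circleMap_one circleMap_two_pi h₂
      rw [wind_trinomial_eq 0 hL₁ hL₂ hp₁ hp₂, Int.cast_zero]
      intro θ
      have := hc0 θ
      rw [he₁, he₂]
      field_simp
      ring
  rcases hn₁.lt_or_gt with h₁ | h₁ <;> rcases hn₂.lt_or_gt with h₂ | h₂
  · refine iff_of_false (fun hu => ?_) ?_
    · refine not_surjective_fwdShift ?_
      have hU := (isUnit_smul_one_add_smul norm_bwdShift_le h₁).mul
        (isUnit_smul_one_add_smul norm_bwdShift_le h₂)
      have heq : (u₁ * u₂) • bwdShift + (u₁ * v₂ + v₁ * u₂) • (1 : EllTwo →L[ℂ] EllTwo)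
          + (v₁ * v₂) • fwdShift = (v₁ • 1 + u₁ • bwdShift) * (v₂ • 1 + u₂ • bwdShift)
            * fwdShift := by
        refine ContinuousLinearMap.ext fun x => ?_
        simp [bwdShift_fwdShift_apply]
        module
      rw [heq, IsUnit.mul_left_iff hU] at hu
      exact (ContinuousLinearMap.isUnit_iff_bijective.1 hu).2
    · obtain ⟨L₁, hL₁, he₁, hp₁⟩ := exists_closed_log hci hni hpi h₁
      obtain ⟨L₂, hL₂, he₂, hp₂⟩ := exists_closed_log hci hni hpi h₂
      rw [wind_trinomial_eq 1 hL₁ hL₂ hp₁ hp₂]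
      · simp
      intro θ
      have := hc0 θ
      rw [he₁, he₂]
      field_simp
      ring
  · exact iff_of_true (mixed _ _ _ _ h₁ h₂).1 (mixed _ _ _ _ h₁ h₂).2
  · have := mixed u₂ v₂ u₁ v₁ h₂ h₁
    rw [mul_comm u₂ u₁, mul_comm v₂ v₁, mul_comm u₂ v₁, mul_comm v₂ u₁, add_comm (v₁ * u₂)] at this
    exact iff_of_true this.1 this.2
  · refine iff_of_false (fun hu => ?_) ?_
    · refine not_injective_bwdShift ?_
      have hU := (isUnit_smul_one_add_smul norm_fwdShift_le h₁).mul
        (isUnit_smul_one_add_smul norm_fwdShift_le h₂)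
      have heq : (u₁ * u₂) • bwdShift + (u₁ * v₂ + v₁ * u₂) • (1 : EllTwo →L[ℂ] EllTwo)
          + (v₁ * v₂) • fwdShift = bwdShift * ((u₁ • 1 + v₁ • fwdShift)
            * (u₂ • 1 + v₂ • fwdShift)) := by
        refine ContinuousLinearMap.ext fun x => ?_
        simp [bwdShift_fwdShift_apply]
        module
      rw [heq, IsUnit.mul_right_iff hU] at hu
      exact (ContinuousLinearMap.isUnit_iff_bijective.1 hu).1
    · obtain ⟨L₁, hL₁, he₁, hp₁⟩ :=
        exists_closed_log hce norm_circleMap_one circleMap_two_pi h₁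
      obtain ⟨L₂, hL₂, he₂, hp₂⟩ :=
        exists_closed_log hce norm_circleMap_one circleMap_two_pi h₂
      rw [wind_trinomial_eq (-1) hL₁ hL₂ hp₁ hp₂]
      · simp
      intro θ
      have := hc0 θ
      rw [he₁, he₂]
      field_simp
      ring

/-! ### Block form of the operator -/

theorem memℓp_two_iff (x : ℕ → ℂ) : Memℓp x 2 ↔ Summable fun n => ‖x n‖ ^ 2 := by
  simpa using memℓp_gen_iff (E := fun _ : ℕ => ℂ) (f := x) (by norm_num : 0 < (2 : ENNReal).toReal)

/-- Splitting a sequence into its subsequences along the residue classes mod `k`: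
the `m`-th term of the component `j` is the term `m k + j` of the sequence. -/
def blockEquiv (k : ℕ) [NeZero k] : EllTwo ≃ₗ[ℂ] (Fin k → EllTwo) where
  toFun x j := ⟨fun m => x (m * k + j), by
    have hj : Function.Injective fun m : ℕ => m * k + (j : ℕ) := fun a b h =>
      Nat.eq_of_mul_eq_mul_right (NeZero.pos k) (Nat.add_right_cancel h)
    exact (memℓp_two_iff _).2 ((EllTwo.summable_norm_sq x).comp_injective hj)⟩
  map_add' x y := rfl
  map_smul' c x := rfl
  invFun X := ⟨fun n => X (Fin.ofNat k n) (n / k), by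
    refine (memℓp_two_iff _).2 ?_
    rw [← (Nat.divModEquiv k).symm.summable_iff]
    have hs : Summable fun p : Fin k × ℕ => ‖X p.1 p.2‖ ^ 2 :=
      (summable_prod_of_nonneg fun _ => by positivity).2
        ⟨fun j => EllTwo.summable_norm_sq (X j), Summable.of_finite⟩
    refine ((Equiv.prodComm ℕ (Fin k)).summable_iff.2 hs).congr fun p => ?_
    have h := (Nat.divModEquiv k).apply_symm_apply p
    exact congrArg (fun q : ℕ × Fin k => ‖X q.2 q.1‖ ^ 2) h.symm⟩
  left_inv x := by
    ext n
    change x (n / k * k + (Fin.ofNat k n : ℕ)) = x n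
    rw [Fin.val_ofNat, Nat.div_add_mod']
  right_inv X := by
    ext j m
    have h := (Nat.divModEquiv k).apply_symm_apply (m, j)
    exact congrArg (fun q : ℕ × Fin k => X q.2 q.1) h

theorem blockEquiv_apply (k : ℕ) [NeZero k] (x : EllTwo) (j : Fin k) (m : ℕ) :
    blockEquiv k x j m = x (m * k + j) := rfl

/-- The block Toeplitz operator with tridiagonal blocks `Q, P, R`, where `Q` stands above and
`R` below the diagonal: the symbol `z⁻¹ Q + P + z R` with `z⁻¹` and `z` replaced by the backward
and the forward shift. -/
noncomputable def blockToeplitz {ι : Type*} [Fintype ι] (Q P R : Matrix ι ι ℂ) :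
    (ι → EllTwo) →L[ℂ] (ι → EllTwo) :=
  ContinuousLinearMap.pi fun i => ∑ j,
    (Q i j • bwdShift + P i j • 1 + R i j • fwdShift) ∘L ContinuousLinearMap.proj j

theorem blockToeplitz_apply {ι : Type*} [Fintype ι] (Q P R : Matrix ι ι ℂ) (X : ι → EllTwo)
    (i : ι) : blockToeplitz Q P R X i
      = ∑ j, (Q i j • bwdShift (X j) + P i j • X j + R i j • fwdShift (X j)) := by
  simp [blockToeplitz]


theorem blockZero_apply {k : ℕ} (α β η : Fin k → ℂ) (i j : Fin k) :
    blockZero k α β η i j = (if j = i then α i else 0)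
      + (if (j : ℕ) = i + 1 then β i else 0) + (if (i : ℕ) = j + 1 then η j else 0) := by
  simp only [blockZero, Matrix.of_apply]
  by_cases h1 : j = i
  · simp [h1]
  · by_cases h2 : (j : ℕ) = i + 1
    · have h3 : (i : ℕ) ≠ j + 1 := by omega
      rw [if_neg h1, if_pos h2, if_neg h1, if_pos h2, if_neg h3]
      ring
    · simp [h1, h2]

theorem Fin.ofNat_mul_add {k : ℕ} [NeZero k] (m : ℕ) (j : Fin k) :
    Fin.ofNat k (m * k + j) = j :=
  Fin.ext (by rw [Fin.val_ofNat, Nat.mul_add_mod_of_lt j.2])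

/-- The superdiagonal entry in row `i` sits in the diagonal block, or in the block to its right
if `i` is the last row. -/
theorem sum_superdiagonal {k : ℕ} [NeZero k] (β : Fin k → ℂ) (x : ℕ → ℂ) (i : Fin k) (m : ℕ) :
    ∑ j : Fin k, (blockSuper k β i j * x ((m + 1) * k + j)
      + (if (j : ℕ) = i + 1 then β i else 0) * x (m * k + j)) = β i * x (m * k + i + 1) := by
  by_cases h : (i : ℕ) + 1 < k
  · rw [Finset.sum_eq_single ⟨i + 1, h⟩]
    · simp [blockSuper, h.ne, add_assoc]
    · intro j _ hj
      have : (j : ℕ) ≠ i + 1 := fun h => hj (Fin.ext h)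
      simp [blockSuper, h.ne, this]
    · simp
  · have hk : (i : ℕ) + 1 = k := by omega
    have hlt : ∀ j : Fin k, (j : ℕ) ≠ i + 1 := fun j => by omega
    rw [Finset.sum_eq_single 0]
    · simp [blockSuper, hk, add_assoc, add_mul, NeZero.ne' k]
    · intro j _ hj
      simp [blockSuper, hlt, hj]
    · simp

/-- The subdiagonal entry in row `i` sits in the diagonal block, or in the block to its left
if `i` is the first row. Here `y j` is the entry in position `j` of the preceding block. -/
theorem sum_subdiagonal {k : ℕ} [NeZero k] (η : Fin k → ℂ) (x : ℕ → ℂ) (y : Fin k → ℂ) (i : Fin k)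
    (m : ℕ) : ∑ j : Fin k, (blockSub k η i j * y j
      + (if (i : ℕ) = j + 1 then η j else 0) * x (m * k + j))
      = if (i : ℕ) = 0 then η (Fin.ofNat k (k - 1)) * y (Fin.ofNat k (k - 1))
        else η (Fin.ofNat k (i - 1)) * x (m * k + (i - 1 : ℕ)) := by
  have hk := NeZero.pos k
  by_cases h : (i : ℕ) = 0
  · have hlast : ((Fin.ofNat k (k - 1) : Fin k) : ℕ) = k - 1 := by
      rw [Fin.val_ofNat, Nat.mod_eq_of_lt (by omega)]
    have hk1 : k - 1 + 1 = k := by omega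
    rw [Finset.sum_eq_single (Fin.ofNat k (k - 1))]
    · simp only [blockSub, Matrix.of_apply, h, hlast, hk1]
      simp [hk.ne]
    · intro j _ hj
      have : (j : ℕ) + 1 ≠ k := fun h' => hj (Fin.ext (by omega))
      simp [blockSub, h, this]
    · simp
  · have hpred : ((Fin.ofNat k (i - 1) : Fin k) : ℕ) = i - 1 := by
      rw [Fin.val_ofNat, Nat.mod_eq_of_lt (by omega)]
    have hi : (i : ℕ) - 1 + 1 = i := by omega
    rw [Finset.sum_eq_single (Fin.ofNat k (i - 1))]
    · simp only [blockSub, Matrix.of_apply, h, hpred, hi]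
      simp
    · intro j _ hj
      have : (i : ℕ) ≠ j + 1 := fun h' => hj (Fin.ext (by omega))
      have h' : i ≠ 0 := fun h' => h (by simp [h'])
      simp [blockSub, h', this]
    · simp

/-- Splitting into residue classes turns the tridiagonal `k`-Toeplitz operator into a block
Toeplitz operator. -/
theorem blockEquiv_kToeplitz (k : ℕ) [NeZero k] (α β η : Fin k → ℂ) (x : EllTwo) :
    blockEquiv k (kToeplitz k α β η x)
      = blockToeplitz (blockSuper k β) (blockZero k α β η) (blockSub k η) (blockEquiv k x) := by
  ext i m
  have hk := NeZero.pos k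
  have hrow : (blockToeplitz (blockSuper k β) (blockZero k α β η) (blockSub k η)
      (blockEquiv k x) i : EllTwo) m
      = α i * x (m * k + i) + β i * x (m * k + i + 1)
        + if (i : ℕ) = 0 then η (Fin.ofNat k (k - 1)) * fwdShift
            (blockEquiv k x (Fin.ofNat k (k - 1))) m
          else η (Fin.ofNat k (i - 1)) * x (m * k + (i - 1 : ℕ)) := by
    have hdiag : α i * x (m * k + i) = ∑ j, (if j = i then α i else 0) * x (m * k + j) := by
      simp
    rw [← sum_superdiagonal β x i m,
      ← sum_subdiagonal η x (fun j => fwdShift (blockEquiv k x j) m) i m, hdiag,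
      ← Finset.sum_add_distrib, ← Finset.sum_add_distrib, blockToeplitz_apply, lp.coeFn_sum,
      Finset.sum_apply]
    refine Finset.sum_congr rfl fun j _ => ?_
    simp only [lp.coeFn_add, lp.coeFn_smul, Pi.add_apply, Pi.smul_apply, smul_eq_mul,
      bwdShift_apply, blockEquiv_apply, blockZero_apply]
    ring
  rw [hrow, blockEquiv_apply, kToeplitz_apply]
  by_cases hi : (i : ℕ) = 0
  · rw [if_pos hi]
    cases m with
    | zero =>
      have h0 : i = Fin.ofNat k 0 := Fin.ext (by simp [hi])
      subst h0
      simp [kToeplitzAction]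
    | succ m =>
      have hlast : ((Fin.ofNat k (k - 1) : Fin k) : ℕ) = k - 1 := by
        rw [Fin.val_ofNat, Nat.mod_eq_of_lt (by omega)]
      have hn : (m + 1) * k + i = m * k + (Fin.ofNat k (k - 1) : Fin k) + 1 := by
        rw [add_mul]; omega
      have hof := Fin.ofNat_mul_add (m + 1) i
      rw [hn] at hof ⊢
      rw [kToeplitzAction, fwdShift_apply_succ, blockEquiv_apply, hof, Fin.ofNat_mul_add]
      ring
  · rw [if_neg hi]
    have hpred : ((Fin.ofNat k (i - 1) : Fin k) : ℕ) = i - 1 := by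
      rw [Fin.val_ofNat, Nat.mod_eq_of_lt (by omega)]
    have hn : m * k + i = m * k + (Fin.ofNat k (i - 1) : Fin k) + 1 := by omega
    have hof := Fin.ofNat_mul_add m i
    have hx : m * k + ((i : ℕ) - 1) = m * k + (Fin.ofNat k (i - 1) : Fin k) := by rw [hpred]
    rw [hx]
    rw [hn] at hof ⊢
    rw [kToeplitzAction, hof, Fin.ofNat_mul_add]
    ring

/-- Invertibility of the operator is invertibility of its block form. -/
theorem isUnit_kToeplitz_iff (k : ℕ) [NeZero k] (α β η : Fin k → ℂ) :
    IsUnit (kToeplitz k α β η) ↔ Function.Bijective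
      (blockToeplitz (blockSuper k β) (blockZero k α β η) (blockSub k η)) := by
  rw [ContinuousLinearMap.isUnit_iff_bijective,
    ← Function.Bijective.of_comp_iff' (blockEquiv k).bijective,
    ← Function.Bijective.of_comp_iff _ (blockEquiv k).bijective]
  refine iff_of_eq (congrArg Function.Bijective (funext fun x => ?_))
  exact blockEquiv_kToeplitz k α β η x

/-! ### Elimination of the residue classes other than the last -/

/-- Solving a linear system in two unknowns after elimination of the second one. -/
theorem bijective_prod_iff_bijective_schur {E F : Type*} [AddCommGroup E] [AddCommGroup F]
    (A : E ≃+ E) (U : F → E) (V : E →+ F) (S : F → F) :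
    Function.Bijective (fun p : F × E => (S p.1 + V p.2, U p.1 + A p.2)) ↔
      Function.Bijective (fun y : F => S y - V (A.symm (U y))) := by
  -- block triangular changes of variables on the source and on the target
  let e₁ : F × E ≃ F × E :=
    { toFun := fun p => (p.1, A.symm (p.2 - U p.1))
      invFun := fun p => (p.1, U p.1 + A p.2)
      left_inv := fun p => by simp
      right_inv := fun p => by simp }
  let e₂ : F × E ≃ F × E :=
    { toFun := fun p => (p.1 - V (A.symm p.2), p.2)
      invFun := fun p => (p.1 + V (A.symm p.2), p.2)
      left_inv := fun p => by simp
      right_inv := fun p => by simp }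
  rw [← Function.Bijective.of_comp_iff' e₂.bijective,
    ← Function.Bijective.of_comp_iff _ e₁.bijective]
  have h : (e₂ ∘ fun p : F × E => (S p.1 + V p.2, U p.1 + A p.2)) ∘ e₁
      = Prod.map (fun y : F => S y - V (A.symm (U y))) id := by
    funext p
    refine Prod.ext ?_ ?_
    · simp [e₁, e₂]
      abel
    · simp [e₁, e₂]
  have : Nonempty E := ⟨0⟩
  have : Nonempty F := ⟨0⟩
  rw [h, Prod.map_bijective]
  exact and_iff_left Function.bijective_id

/-- A matrix acting on vectors with entries in a module. -/
def Matrix.smulVec {ι κ E : Type*} [Fintype κ] [AddCommGroup E] [Module ℂ E]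
    (P : Matrix ι κ ℂ) : (κ → E) →+ (ι → E) where
  toFun X i := ∑ j, P i j • X j
  map_zero' := by ext; simp
  map_add' X Y := by ext; simp [Finset.sum_add_distrib]

theorem Matrix.smulVec_apply {ι κ E : Type*} [Fintype κ] [AddCommGroup E] [Module ℂ E]
    (P : Matrix ι κ ℂ) (X : κ → E) (i : ι) : P.smulVec X i = ∑ j, P i j • X j := rfl

theorem Matrix.smulVec_smulVec {ι κ l E : Type*} [Fintype κ] [Fintype l] [AddCommGroup E]
    [Module ℂ E] (P : Matrix ι κ ℂ) (Q : Matrix κ l ℂ) (X : l → E) :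
    P.smulVec (Q.smulVec X) = (P * Q).smulVec X := by
  ext i
  simp only [Matrix.smulVec_apply, Matrix.mul_apply, Finset.smul_sum, Finset.sum_smul, mul_smul]
  exact Finset.sum_comm

theorem Matrix.one_smulVec {ι E : Type*} [Fintype ι] [DecidableEq ι] [AddCommGroup E]
    [Module ℂ E] (X : ι → E) : (1 : Matrix ι ι ℂ).smulVec X = X := by
  ext i
  simp [Matrix.smulVec_apply, Matrix.one_apply]

/-- The action of an invertible matrix. -/
noncomputable def Matrix.smulVecEquiv {ι E : Type*} [Fintype ι] [DecidableEq ι] [AddCommGroup E]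
    [Module ℂ E] (P : Matrix ι ι ℂ) (hP : IsUnit P.det) : (ι → E) ≃+ (ι → E) :=
  { P.smulVec with
    invFun := P⁻¹.smulVec
    left_inv := fun X => by
      change P⁻¹.smulVec (P.smulVec X) = X
      rw [smulVec_smulVec, nonsing_inv_mul _ hP, one_smulVec]
    right_inv := fun X => by
      change P.smulVec (P⁻¹.smulVec X) = X
      rw [smulVec_smulVec, mul_nonsing_inv _ hP, one_smulVec] }

/-- The determinant in terms of the Schur complement of the block without last row and column. -/
theorem Matrix.det_eq_mul_schur {n : ℕ} (M : Matrix (Fin (n + 1)) (Fin (n + 1)) ℂ)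
    (hM : IsUnit (M.submatrix Fin.castSucc Fin.castSucc).det) :
    M.det = (M.submatrix Fin.castSucc Fin.castSucc).det * (M (Fin.last n) (Fin.last n)
      - ∑ i, ∑ j, M (Fin.last n) i.castSucc * (M.submatrix Fin.castSucc Fin.castSucc)⁻¹ i j
        * M j.castSucc (Fin.last n)) := by
  have hblock : M.submatrix finSumFinEquiv finSumFinEquiv = Matrix.fromBlocks
      (M.submatrix Fin.castSucc Fin.castSucc)
      (Matrix.of fun (i : Fin n) (_ : Fin 1) => M i.castSucc (Fin.last n))
      (Matrix.of fun (_ : Fin 1) (j : Fin n) => M (Fin.last n) j.castSucc)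
      (Matrix.of fun (_ : Fin 1) (_ : Fin 1) => M (Fin.last n) (Fin.last n)) := by
    have hlast : ∀ i : Fin 1, Fin.natAdd n i = Fin.last n := fun i => by
      rw [Subsingleton.elim i 0]; rfl
    ext (i | i) (j | j) <;> simp [hlast] <;> rfl
  let : Invertible (M.submatrix Fin.castSucc Fin.castSucc) :=
    Matrix.invertibleOfIsUnitDet _ hM
  rw [← Matrix.det_submatrix_equiv_self finSumFinEquiv M, hblock, Matrix.det_fromBlocks₁₁,
    Matrix.det_fin_one, Matrix.invOf_eq_nonsing_inv]
  congr 1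
  simp only [Matrix.sub_apply, Matrix.of_apply, Matrix.mul_apply, Finset.sum_mul]
  rw [Finset.sum_comm]

/-- If the scalar block of the diagonal block obtained by deleting its last row and column is
invertible, elimination of all but the last residue class turns the block Toeplitz operator into
a scalar tridiagonal one, whose symbol is the determinant of the matrix symbol. -/
theorem exists_scalar_toeplitz {n : ℕ} (Q P R : Matrix (Fin (n + 1)) (Fin (n + 1)) ℂ)
    (hQ : ∀ i j, Q (Fin.castSucc i) j = 0) (hR : ∀ i j, R i (Fin.castSucc j) = 0)
    (hP : IsUnit (P.submatrix Fin.castSucc Fin.castSucc).det) :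
    ∃ a b c : ℂ, (Function.Bijective (blockToeplitz Q P R) ↔
        IsUnit (a • bwdShift + b • (1 : EllTwo →L[ℂ] EllTwo) + c • fwdShift)) ∧
      ∀ z : ℂ, z ≠ 0 → (z⁻¹ • Q + P + z • R).det = a * z⁻¹ + b + c * z := by
  set B := P.submatrix Fin.castSucc Fin.castSucc with hB
  set N := B⁻¹ with hN
  let l := Fin.last n
  -- `q`, `p'`, `p`, `r` are the parts of the last row and column without the corner entry, and
  -- `φ` is the bilinear form of `B⁻¹`; `a`, `b`, `c` are the coefficients of the Schur complement
  let φ : (Fin n → ℂ) → (Fin n → ℂ) → ℂ := fun v u => ∑ i, ∑ j, v i * N i j * u j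
  let q : Fin n → ℂ := fun j => Q l j.castSucc
  let p' : Fin n → ℂ := fun j => P l j.castSucc
  let p : Fin n → ℂ := fun i => P i.castSucc l
  let r : Fin n → ℂ := fun i => R i.castSucc l
  let a := Q l l - φ q p
  let b := P l l - φ p' p - φ q r
  let c := R l l - φ p' r
  refine ⟨B.det * a, B.det * b, B.det * c, ?_, fun z hz => ?_⟩
  · let A := B.smulVecEquiv (E := EllTwo) hP
    let U : EllTwo → (Fin n → EllTwo) := fun y i => p i • y + r i • fwdShift y
    let V : (Fin n → EllTwo) →+ EllTwo :=
      { toFun := fun X => ∑ j, (q j • bwdShift (X j) + p' j • X j)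
        map_zero' := by simp
        map_add' := fun X Y => by
          rw [← Finset.sum_add_distrib]
          refine Finset.sum_congr rfl fun j _ => ?_
          simp only [Pi.add_apply, map_add]
          module }
    let S : EllTwo → EllTwo := fun y => Q l l • bwdShift y + P l l • y + R l l • fwdShift y
    let e := Fin.snocEquiv (fun _ : Fin (n + 1) => EllTwo)
    have hsys : e.symm ∘ blockToeplitz Q P R ∘ e
        = fun x : EllTwo × (Fin n → EllTwo) => (S x.1 + V x.2, U x.1 + A x.2) := by
      funext x
      have hA : ∀ i, A x.2 i = ∑ j, P i.castSucc j.castSucc • x.2 j := fun i => rfl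
      have hec : ∀ j, e x (Fin.castSucc j) = x.2 j := fun j => by simp [e, Fin.snocEquiv]
      have hel : e x (Fin.last n) = x.1 := by simp [e, Fin.snocEquiv]
      refine Prod.ext ?_ (funext fun i => ?_)
      · change blockToeplitz Q P R (e x) (Fin.last n) = _
        rw [blockToeplitz_apply, Fin.sum_univ_castSucc, hel]
        simp only [hec, hR, zero_smul, add_zero]
        exact add_comm _ _
      · change blockToeplitz Q P R (e x) i.castSucc = _
        rw [blockToeplitz_apply, Fin.sum_univ_castSucc, hel]
        simp only [hec, hR, hQ, zero_smul, add_zero, zero_add]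
        rw [Pi.add_apply, hA]
        exact add_comm _ _
    have hV : ∀ y, V (A.symm (U y)) = φ q p • bwdShift y + (φ p' p + φ q r) • y
        + φ p' r • fwdShift y := fun y => by
      have hAs : ∀ j, A.symm (U y) j = ∑ m, N j m • U y m := fun j => rfl
      change ∑ j, (q j • bwdShift (A.symm (U y) j) + p' j • A.symm (U y) j) = _
      simp only [hAs, φ, map_sum, Finset.smul_sum, Finset.sum_smul, add_smul,
        ← Finset.sum_add_distrib, map_smul, U, map_add, bwdShift_fwdShift_apply]
      refine Finset.sum_congr rfl fun j _ => Finset.sum_congr rfl fun m _ => ?_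
      module
    have hschur : (fun y => S y - V (A.symm (U y)))
        = ⇑(a • bwdShift + b • (1 : EllTwo →L[ℂ] EllTwo) + c • fwdShift) := by
      funext y
      rw [hV]
      simp [S, a, b, c]
      module
    have hscale : (B.det * a) • bwdShift + (B.det * b) • (1 : EllTwo →L[ℂ] EllTwo)
        + (B.det * c) • fwdShift
        = hP.unit • (a • bwdShift + b • (1 : EllTwo →L[ℂ] EllTwo) + c • fwdShift) := by
      rw [Units.smul_def, IsUnit.unit_spec]
      module
    rw [hscale, isUnit_smul_iff, ContinuousLinearMap.isUnit_iff_bijective, ← hschur,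
      ← bijective_prod_iff_bijective_schur A U V S, ← hsys,
      Function.Bijective.of_comp_iff' e.symm.bijective, Function.Bijective.of_comp_iff _ e.bijective]
  · have hsub : (z⁻¹ • Q + P + z • R).submatrix Fin.castSucc Fin.castSucc = B := by
      ext i j
      simp [hQ, hR, hB]
    have hM := Matrix.det_eq_mul_schur (z⁻¹ • Q + P + z • R) (by rw [hsub]; exact hP)
    rw [hsub] at hM
    rw [hM, mul_assoc, mul_assoc, ← mul_add, ← mul_add]
    congr 1
    have hφ : ∑ i, ∑ j, (z⁻¹ • Q + P + z • R) (Fin.last n) i.castSucc * B⁻¹ i j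
        * (z⁻¹ • Q + P + z • R) j.castSucc (Fin.last n)
        = φ q p * z⁻¹ + (φ p' p + φ q r) + φ p' r * z := by
      simp only [φ, Finset.sum_mul, ← Finset.sum_add_distrib]
      refine Finset.sum_congr rfl fun i _ => Finset.sum_congr rfl fun j _ => ?_
      simp only [Matrix.add_apply, Matrix.smul_apply, hQ, hR, smul_eq_mul, q, p', p, r, l, hN]
      field_simp
      ring
    rw [hφ]
    simp only [Matrix.add_apply, Matrix.smul_apply, smul_eq_mul, a, b, c, l]
    ring

/-! ### Approximate eigenvectors -/

/-- The geometric sequence `1, w, w², …` in `ℓ²(ℕ)`. -/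
def geometric (w : ℂ) (hw : ‖w‖ < 1) : EllTwo := ⟨fun n => w ^ n, (memℓp_two_iff _).2 <| by
  refine (summable_geometric_of_lt_one (sq_nonneg ‖w‖) ?_).congr fun n => ?_
  · exact pow_lt_one₀ (norm_nonneg _) hw two_ne_zero
  · rw [norm_pow, pow_right_comm]⟩

@[simp]
theorem geometric_apply (w : ℂ) (hw : ‖w‖ < 1) (n : ℕ) : geometric w hw n = w ^ n := rfl

theorem norm_geometric (w : ℂ) (hw : ‖w‖ < 1) :
    ‖geometric w hw‖ = √((1 - ‖w‖ ^ 2)⁻¹) := by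
  rw [← tsum_geometric_of_lt_one (sq_nonneg ‖w‖) (pow_lt_one₀ (norm_nonneg _) hw two_ne_zero)]
  rw [← Real.sqrt_sq (norm_nonneg (geometric w hw)), EllTwo.norm_sq_eq_tsum]
  congr 2
  funext n
  rw [geometric_apply, norm_pow, pow_right_comm]

theorem bwdShift_geometric (w : ℂ) (hw : ‖w‖ < 1) :
    bwdShift (geometric w hw) = w • geometric w hw := by
  ext n
  simp [pow_succ']

theorem fwdShift_geometric (w : ℂ) (hw : ‖w‖ < 1) (h0 : w ≠ 0) :
    fwdShift (geometric w hw) = w⁻¹ • (geometric w hw - lp.single 2 0 1) := by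
  ext n
  change fwdShift (geometric w hw) n
    = w⁻¹ * (geometric w hw n - (lp.single 2 0 1 : EllTwo) n)
  cases n with
  | zero => simp
  | succ n => simp [pow_succ', h0]

/-- A block Toeplitz operator maps `v` times a geometric sequence to the value of the symbol at
`w⁻¹` times this sequence, up to an error in the first block. -/
theorem blockToeplitz_geometric {ι : Type*} [Fintype ι] (Q P R : Matrix ι ι ℂ) (v : ι → ℂ)
    (w : ℂ) (hw : ‖w‖ < 1) (h0 : w ≠ 0) (i : ι) :
    blockToeplitz Q P R (fun j => v j • geometric w hw) i
      = ((w • Q.mulVec v + P.mulVec v + w⁻¹ • R.mulVec v) i) • geometric w hw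
        - (w⁻¹ * R.mulVec v i) • (lp.single 2 0 1 : EllTwo) := by
  rw [blockToeplitz_apply]
  simp only [Pi.add_apply, Pi.smul_apply, smul_eq_mul, Matrix.mulVec, dotProduct, Finset.mul_sum,
    ← Finset.sum_add_distrib, Finset.sum_smul]
  rw [← Finset.sum_sub_distrib]
  refine Finset.sum_congr rfl fun j _ => ?_
  rw [map_smul, map_smul, bwdShift_geometric, fwdShift_geometric w hw h0]
  module

/-- A block Toeplitz operator whose symbol is singular at a point of the unit circle is not
bounded below: geometric sequences with ratio tending to the circle are approximate
eigenvectors. -/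
theorem not_bijective_blockToeplitz {ι : Type*} [Fintype ι] [DecidableEq ι] (Q P R : Matrix ι ι ℂ)
    {z : ℂ} (hz : ‖z‖ = 1) (hdet : (z⁻¹ • Q + P + z • R).det = 0) :
    ¬ Function.Bijective (blockToeplitz Q P R) := by
  intro hbij
  obtain ⟨v, hv0, hv⟩ := Matrix.exists_mulVec_eq_zero_iff.2 hdet
  obtain ⟨j₀, hj₀⟩ := Function.ne_iff.1 hv0
  obtain ⟨-, K, hK⟩ :=
    (blockToeplitz Q P R).bijective_iff_dense_range_and_antilipschitz.1 hbij
  have hz0 : z ≠ 0 := norm_pos_iff.1 (hz ▸ zero_lt_one)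
  let u : ℝ → ι → ℂ := fun t =>
    (t * z⁻¹ : ℂ) • Q.mulVec v + P.mulVec v + (t * z⁻¹ : ℂ)⁻¹ • R.mulVec v
  let e : ℝ → ι → ℂ := fun t => (t * z⁻¹ : ℂ)⁻¹ • R.mulVec v
  have hne : ((1 : ℝ) * z⁻¹ : ℂ) ≠ 0 := by simpa using hz0
  have hu : Filter.Tendsto (fun t => ‖u t‖) (nhdsWithin 1 (Set.Iio 1)) (nhds 0) := by
    have hc : ContinuousAt (fun t => ‖u t‖) 1 := by
      refine ContinuousAt.norm
        (ContinuousAt.add (by fun_prop) (ContinuousAt.fun_smul ?_ continuousAt_const))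
      exact ContinuousAt.inv₀ (by fun_prop) hne
    have h1 : ‖u 1‖ = 0 := by
      rw [norm_eq_zero, ← hv, Matrix.add_mulVec, Matrix.add_mulVec, Matrix.smul_mulVec,
        Matrix.smul_mulVec]
      simp [u]
    exact h1 ▸ hc.tendsto.mono_left nhdsWithin_le_nhds
  have he : Filter.Tendsto (fun t => K * ‖e t‖) (nhdsWithin 1 (Set.Iio 1))
      (nhds (K * ‖e 1‖)) := by
    have hc : ContinuousAt (fun t => K * ‖e t‖) 1 := by
      refine continuousAt_const.mul (ContinuousAt.norm (ContinuousAt.fun_smul ?_ continuousAt_const))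
      exact ContinuousAt.inv₀ (by fun_prop) hne
    exact hc.tendsto.mono_left nhdsWithin_le_nhds
  have hg : Filter.Tendsto (fun t : ℝ => √((1 - t ^ 2)⁻¹)) (nhdsWithin 1 (Set.Iio 1))
      Filter.atTop := by
    refine Real.tendsto_sqrt_atTop.comp (Filter.Tendsto.inv_tendsto_nhdsGT_zero ?_)
    refine tendsto_nhdsWithin_iff.2 ⟨?_, ?_⟩
    · have hc : ContinuousAt (fun t : ℝ => 1 - t ^ 2) 1 := by fun_prop
      have := hc.tendsto.mono_left (nhdsWithin_le_nhds (s := Set.Iio 1))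
      simpa using this
    · filter_upwards [Ioo_mem_nhdsLT (zero_lt_one (α := ℝ))] with t ht
      exact sub_pos.2 (pow_lt_one₀ ht.1.le ht.2 two_ne_zero)
  -- the lower bound for the operator, applied to `v` times the geometric sequence of ratio `t / z`
  have key : ∀ t ∈ Set.Ioo (0 : ℝ) 1,
      (‖v j₀‖ - K * ‖u t‖) * √((1 - t ^ 2)⁻¹) ≤ K * ‖e t‖ := by
    intro t ht
    have hnorm : ‖(t * z⁻¹ : ℂ)‖ = t := by
      rw [norm_mul, norm_inv, hz, inv_one, mul_one, Complex.norm_real, Real.norm_of_nonneg ht.1.le]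
    have hw : ‖(t * z⁻¹ : ℂ)‖ < 1 := hnorm.trans_lt ht.2
    have hw0 : (t * z⁻¹ : ℂ) ≠ 0 := norm_pos_iff.1 (hnorm.symm ▸ ht.1)
    set g := geometric (t * z⁻¹) hw with hgdef
    have hgn : ‖g‖ = √((1 - t ^ 2)⁻¹) := by rw [hgdef, norm_geometric, hnorm]
    let X : ι → EllTwo := fun j => v j • g
    have hX : ‖v j₀‖ * ‖g‖ ≤ ‖X‖ := by
      rw [← norm_smul]
      exact norm_le_pi_norm X j₀
    have hMX : ‖blockToeplitz Q P R X‖ ≤ ‖u t‖ * ‖g‖ + ‖e t‖ := by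
      refine (pi_norm_le_iff_of_nonneg (by positivity)).2 fun i => ?_
      rw [blockToeplitz_geometric Q P R v _ hw hw0]
      refine (norm_sub_le _ _).trans (add_le_add ?_ ?_)
      · rw [norm_smul]
        exact mul_le_mul_of_nonneg_right (norm_le_pi_norm (u t) i) (norm_nonneg _)
      · rw [norm_smul, lp.norm_single (by norm_num), norm_one, mul_one]
        exact norm_le_pi_norm (e t) i
    have hbound : ‖X‖ ≤ K * ‖blockToeplitz Q P R X‖ := by
      simpa using hK.le_mul_dist X 0
    have := hX.trans (hbound.trans (mul_le_mul_of_nonneg_left hMX K.2))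
    rw [← hgn]
    linarith
  have hlim : Filter.Tendsto (fun t : ℝ => (‖v j₀‖ - K * ‖u t‖) * √((1 - t ^ 2)⁻¹))
      (nhdsWithin 1 (Set.Iio 1)) Filter.atTop := by
    refine Filter.Tendsto.pos_mul_atTop (norm_pos_iff.2 hj₀) ?_ hg
    simpa using (hu.const_mul (K : ℝ)).const_sub ‖v j₀‖
  obtain ⟨t, h1, h2, ht⟩ := ((hlim.eventually_ge_atTop (K * ‖e 1‖ + 1)).and
    ((he.eventually_lt_const (lt_add_one _)).and
      (Ioo_mem_nhdsLT (zero_lt_one (α := ℝ))))).exists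
  have := key t ht
  linarith

/-! ### The determinant of the symbol along the unit circle -/

theorem wind_congr {g₁ g₂ : ℂ → ℂ} (h : ∀ z : ℂ, ‖z‖ = 1 → g₁ z = g₂ z) (p : ℂ) :
    wind g₁ p = wind g₂ p := by
  have h' : ∀ θ : ℝ, g₁ (circleMap 0 1 θ) = g₂ (circleMap 0 1 θ) := fun θ =>
    h _ (norm_circleMap_one θ)
  simp only [wind, h']

theorem contDiff_det {ι : Type*} [Fintype ι] [DecidableEq ι] {F : ℝ → Matrix ι ι ℂ}
    (h : ∀ i j, ContDiff ℝ 1 fun t => F t i j) : ContDiff ℝ 1 fun t => (F t).det := by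
  simp only [Matrix.det_apply']
  exact ContDiff.sum fun σ _ => contDiff_const.mul (contDiff_prod fun i _ => h _ _)

theorem contDiff_det_symbol (k : ℕ) (α β η : Fin k → ℂ) (lam : ℂ) :
    ContDiff ℝ 1 fun t : ℝ => (kToeplitzSymbol k α β η (circleMap 0 1 t)
      - lam • (1 : Matrix (Fin k) (Fin k) ℂ)).det := by
  refine contDiff_det fun i j => ?_
  simp only [kToeplitzSymbol, Matrix.sub_apply, Matrix.add_apply, Matrix.smul_apply, smul_eq_mul]
  exact (((contDiff_inv_circleMap.mul contDiff_const).add contDiff_const).add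
    ((contDiff_circleMap 0 1).mul contDiff_const)).sub contDiff_const

theorem continuous_det_symbol (k : ℕ) (α β η : Fin k → ℂ) :
    Continuous fun q : ℂ × ℝ => (kToeplitzSymbol k α β η (circleMap 0 1 q.2)
      - q.1 • (1 : Matrix (Fin k) (Fin k) ℂ)).det := by
  refine Continuous.matrix_det ?_
  have h1 : Continuous fun q : ℂ × ℝ => circleMap 0 1 q.2 :=
    (continuous_circleMap 0 1).comp continuous_snd
  have h2 : Continuous fun q : ℂ × ℝ => (circleMap 0 1 q.2)⁻¹ :=
    contDiff_inv_circleMap.continuous.comp continuous_snd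
  exact (((h2.smul continuous_const).add continuous_const).add (h1.smul continuous_const)).sub
    (continuous_fst.smul continuous_const)

theorem det_symbol_ne_zero {k : ℕ} {α β η : Fin k → ℂ} {lam : ℂ}
    (h : lam ∉ sigmaDet (kToeplitzSymbol k α β η)) (z : ℂ) (hz : ‖z‖ = 1) :
    (kToeplitzSymbol k α β η z - lam • (1 : Matrix (Fin k) (Fin k) ℂ)).det ≠ 0 :=
  fun h0 => h ⟨z, hz, h0⟩

/-- Near a point outside `σ_det` the winding number of the determinant is constant. -/
theorem eventually_wind_det_eq {k : ℕ} {α β η : Fin k → ℂ} {lam₀ : ℂ}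
    (h : lam₀ ∉ sigmaDet (kToeplitzSymbol k α β η)) :
    ∀ᶠ lam in nhds lam₀,
      lam ∉ sigmaDet (kToeplitzSymbol k α β η) ∧
      wind (fun z => (kToeplitzSymbol k α β η z
          - lam • (1 : Matrix (Fin k) (Fin k) ℂ)).det) 0
        = wind (fun z => (kToeplitzSymbol k α β η z
          - lam₀ • (1 : Matrix (Fin k) (Fin k) ℂ)).det) 0 := by
  have hD := continuous_det_symbol k α β η
  set D : ℂ × ℝ → ℂ := fun q => (kToeplitzSymbol k α β η (circleMap 0 1 q.2)
    - q.1 • (1 : Matrix (Fin k) (Fin k) ℂ)).det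
  have hnear : ∀ᶠ lam in nhds lam₀, ∀ θ ∈ Set.Icc (0 : ℝ) (2 * Real.pi),
      ‖D (lam, θ) - D (lam₀, θ)‖ < ‖D (lam₀, θ)‖ := by
    refine isCompact_Icc.eventually_forall_of_forall_eventually fun θ _ => ?_
    have h₀ : Continuous fun q : ℂ × ℝ => D (lam₀, q.2) := hD.comp (by fun_prop)
    refine Filter.Tendsto.eventually_lt ((hD.sub h₀).norm.tendsto (lam₀, θ))
      (h₀.norm.tendsto (lam₀, θ)) ?_
    rw [Pi.sub_apply, sub_self, norm_zero]
    exact norm_pos_iff.2 (det_symbol_ne_zero h _ (norm_circleMap_one θ))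
  filter_upwards [hnear] with lam hlam
  refine ⟨?_, wind_eq_of_norm_sub_lt (contDiff_det_symbol k α β η lam₀)
    (contDiff_det_symbol k α β η lam) hlam⟩
  rintro ⟨z, hz, hdet⟩
  have hzmem : z ∈ circleMap 0 1 '' Set.Ioc 0 (2 * Real.pi) := by
    rw [image_circleMap_Ioc]
    simpa using hz
  obtain ⟨θ, hθ, rfl⟩ := hzmem
  have h1 := hlam θ (Set.Ioc_subset_Icc_self hθ)
  have h2 : D (lam, θ) = 0 := hdet
  rw [h2, zero_sub, norm_neg] at h1
  exact h1.false

/-! ### The spectral parameter -/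

theorem kToeplitz_sub_const (k : ℕ) [NeZero k] (α β η : Fin k → ℂ) (lam : ℂ) :
    kToeplitz k (fun i => α i - lam) β η
      = kToeplitz k α β η - algebraMap ℂ (EllTwo →L[ℂ] EllTwo) lam := by
  ext x n
  change kToeplitzAction k (fun i => α i - lam) β η x n
    = kToeplitzAction k α β η x n - lam * x n
  cases n <;> simp only [kToeplitzAction] <;> ring

theorem blockZero_sub_const (k : ℕ) (α β η : Fin k → ℂ) (lam : ℂ) :
    blockZero k (fun i => α i - lam) β η
      = blockZero k α β η - lam • (1 : Matrix (Fin k) (Fin k) ℂ) := by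
  ext i j
  by_cases h : j = i
  · simp [blockZero, h]
  · simp [blockZero, h, Ne.symm h]

theorem kToeplitzSymbol_sub_const (k : ℕ) (α β η : Fin k → ℂ) (lam z : ℂ) :
    kToeplitzSymbol k (fun i => α i - lam) β η z
      = kToeplitzSymbol k α β η z - lam • (1 : Matrix (Fin k) (Fin k) ℂ) := by
  rw [kToeplitzSymbol, kToeplitzSymbol, blockZero_sub_const]
  abel

theorem leadingBlock_sub_const (k : ℕ) (α β η : Fin k → ℂ) (lam : ℂ) :
    leadingBlock k (fun i => α i - lam) β η
      = leadingBlock k α β η - algebraMap ℂ (Matrix (Fin (k - 1)) (Fin (k - 1)) ℂ) lam := by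
  ext i j
  simp [leadingBlock, blockZero_sub_const, Matrix.one_apply, Matrix.algebraMap_matrix_apply]

theorem notMem_spectrum_iff_isUnit_sub {A : Type*} [Ring A] [Algebra ℂ A] (a : A) (lam : ℂ) :
    lam ∉ spectrum ℂ a ↔ IsUnit (a - algebraMap ℂ A lam) := by
  rw [spectrum.notMem_iff, ← IsUnit.neg_iff, neg_sub]

/-- Invertibility of the operator at the spectral parameter `0`, outside `σ_det ∪ σ(B₀)`. -/
theorem isUnit_kToeplitz_iff_wind_eq_zero (k : ℕ) [NeZero k] (α β η : Fin k → ℂ)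
    (hB : IsUnit (leadingBlock k α β η))
    (h : ∀ z : ℂ, ‖z‖ = 1 → (kToeplitzSymbol k α β η z).det ≠ 0) :
    IsUnit (kToeplitz k α β η) ↔ wind (fun z => (kToeplitzSymbol k α β η z).det) 0 = 0 := by
  obtain ⟨n, rfl⟩ := Nat.exists_eq_succ_of_ne_zero (NeZero.ne k)
  obtain ⟨a, b, c, hiff, hdet⟩ := exists_scalar_toeplitz (blockSuper (n + 1) β)
    (blockZero (n + 1) α β η) (blockSub (n + 1) η)
    (fun i j => by simp [blockSuper, i.2.ne]) (fun i j => by simp [blockSub, j.2.ne])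
    ((Matrix.isUnit_iff_isUnit_det _).1 hB)
  have hdet' : ∀ z : ℂ, ‖z‖ = 1 → (kToeplitzSymbol (n + 1) α β η z).det
      = a * z⁻¹ + b + c * z := fun z hz => hdet z (norm_pos_iff.1 (hz ▸ zero_lt_one))
  rw [isUnit_kToeplitz_iff, hiff, wind_congr hdet',
    isUnit_trinomial_iff fun z hz => hdet' z hz ▸ h z hz]

/-- Outside `σ_det ∪ σ(B₀)` the spectrum is the set of points with nonzero winding number. -/
theorem mem_spectrum_kToeplitz_iff {k : ℕ} [NeZero k] {α β η : Fin k → ℂ} {lam : ℂ}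
    (hB : lam ∉ spectrum ℂ (leadingBlock k α β η))
    (h : lam ∉ sigmaDet (kToeplitzSymbol k α β η)) :
    lam ∈ spectrum ℂ (kToeplitz k α β η) ↔ lam ∈ sigmaWind (kToeplitzSymbol k α β η) := by
  rw [notMem_spectrum_iff_isUnit_sub, ← leadingBlock_sub_const] at hB
  rw [← not_iff_not, notMem_spectrum_iff_isUnit_sub, ← kToeplitz_sub_const,
    isUnit_kToeplitz_iff_wind_eq_zero k _ β η hB fun z hz => by
      rw [kToeplitzSymbol_sub_const]; exact det_symbol_ne_zero h z hz]
  simp only [kToeplitzSymbol_sub_const, sigmaWind, Set.mem_ofPred_eq, h, not_false_eq_true,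
    true_and, not_not]

theorem sigmaDet_subset_spectrum (k : ℕ) [NeZero k] (α β η : Fin k → ℂ) :
    sigmaDet (kToeplitzSymbol k α β η) ⊆ spectrum ℂ (kToeplitz k α β η) := by
  rintro lam ⟨z, hz, hdet⟩
  by_contra hlam
  rw [notMem_spectrum_iff_isUnit_sub, ← kToeplitz_sub_const, isUnit_kToeplitz_iff] at hlam
  rw [← kToeplitzSymbol_sub_const] at hdet
  exact not_bijective_blockToeplitz _ _ _ hz hdet hlam

/-- Points of `σ_wind` that are eigenvalues of `B₀` are limits of points of `σ_wind` that are
not, and the spectrum is closed. -/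
theorem sigmaWind_subset_spectrum (k : ℕ) [NeZero k] (α β η : Fin k → ℂ) :
    sigmaWind (kToeplitzSymbol k α β η) ⊆ spectrum ℂ (kToeplitz k α β η) := by
  rintro lam₀ ⟨hdet, hw⟩
  refine (spectrum.isClosed (𝕜 := ℂ) (kToeplitz k α β η)).mem_of_tendsto
    (b := nhdsWithin lam₀ {lam₀}ᶜ) (f := id) (Filter.tendsto_id.mono_left nhdsWithin_le_nhds) ?_
  have hB : ∀ᶠ lam in nhdsWithin lam₀ {lam₀}ᶜ, lam ∉ spectrum ℂ (leadingBlock k α β η) :=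
    (Matrix.finite_spectrum (leadingBlock k α β η)).eventually_cofinite_notMem.filter_mono
      (nhdsNE_le_cofinite lam₀)
  filter_upwards [hB, (eventually_wind_det_eq hdet).filter_mono nhdsWithin_le_nhds]
    with lam h1 h2
  exact (mem_spectrum_kToeplitz_iff h1 h2.1).2 ⟨h2.1, by rw [h2.2]; exact hw⟩

/-! ### Eigenvalue traces -/

/-- The determinant of `f - λ` along the circle is, by evaluation of the characteristic
polynomial at `λ`, the product of the traces shifted by `λ`. -/
theorem det_symbol_eq_prod {k : ℕ} {f : ℂ → Matrix (Fin k) (Fin k) ℂ} {ev : Fin k → ℝ → ℂ}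
    (hev : IsEigenvalueTraces f ev) (lam : ℂ) {θ : ℝ} (hθ : θ ∈ Set.Icc (0 : ℝ) (2 * Real.pi)) :
    (f (circleMap 0 1 θ) - lam • (1 : Matrix (Fin k) (Fin k) ℂ)).det
      = ∏ j, (ev j θ - lam) := by
  have h := congrArg (Polynomial.eval lam) (hev.2 θ hθ)
  rw [Matrix.eval_charpoly, Polynomial.eval_prod] at h
  have hscalar : Matrix.scalar (Fin k) lam = lam • (1 : Matrix (Fin k) (Fin k) ℂ) :=
    (Matrix.smul_one_eq_diagonal lam).symm
  rw [← neg_sub, Matrix.det_neg, ← hscalar, h, Fintype.card, ← Finset.prod_neg]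
  simp

theorem sigmaWind_eq_sigmaWindTraces {k : ℕ} (α β η : Fin k → ℂ) (ev : Fin k → ℝ → ℂ)
    (hev : IsEigenvalueTraces (kToeplitzSymbol k α β η) ev) :
    sigmaWind (kToeplitzSymbol k α β η) = sigmaWindTraces (kToeplitzSymbol k α β η) ev := by
  -- logarithms of the traces add up to a logarithm of the determinant
  have hsum : ∀ (lam : ℂ) (w : Fin k → ℂ), (∀ j, HasPathIndex (ev j) lam (w j)) →
      wind (fun z => (kToeplitzSymbol k α β η z
        - lam • (1 : Matrix (Fin k) (Fin k) ℂ)).det) 0 = ∑ j, w j := by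
    intro lam w hw
    choose L hLc hLe hLw using hw
    rw [wind_eq_of_exp_eq (L := fun θ => ∑ j, L j θ) (contDiff_det_symbol k α β η lam)
      (continuousOn_finsetSum _ fun j _ => hLc j)]
    · simp only [hLw, ← Finset.mul_sum, Finset.sum_sub_distrib]
    · intro θ hθ
      rw [Complex.exp_sum, sub_zero, det_symbol_eq_prod hev lam hθ]
      exact Finset.prod_congr rfl fun j _ => hLe j θ hθ
  ext lam
  constructor
  · rintro ⟨hdet, hw⟩
    have hne : ∀ j, ∀ θ ∈ Set.Icc (0 : ℝ) (2 * Real.pi), ev j θ - lam ≠ 0 := fun j θ hθ => by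
      have := det_symbol_ne_zero hdet _ (norm_circleMap_one θ)
      rw [det_symbol_eq_prod hev lam hθ] at this
      exact Finset.prod_ne_zero_iff.1 this j (Finset.mem_univ j)
    choose L hLc hLe using fun j =>
      exists_continuousOn_log (by positivity) ((hev.1 j).sub continuousOn_const) (hne j)
    have hidx : ∀ j, HasPathIndex (ev j) lam
        ((2 * Real.pi * Complex.I)⁻¹ * (L j (2 * Real.pi) - L j 0)) := fun j =>
      ⟨L j, hLc j, hLe j, rfl⟩
    exact ⟨hdet, _, hidx, by rw [← hsum lam _ hidx]; exact hw⟩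
  · rintro ⟨hdet, w, hidx, hw⟩
    exact ⟨hdet, by rw [hsum lam w hidx]; exact hw⟩

/-! ### Spectrum of the tridiagonal Toeplitz operator -/

theorem mainTheorem5 (k : ℕ) [NeZero k] (α β η : Fin k → ℂ) :
    (sigmaDet (kToeplitzSymbol k α β η) ∪ sigmaWind (kToeplitzSymbol k α β η)
        ⊆ spectrum ℂ (kToeplitz k α β η) ∧
      spectrum ℂ (kToeplitz k α β η)
        ⊆ sigmaDet (kToeplitzSymbol k α β η) ∪ sigmaWind (kToeplitzSymbol k α β η)
          ∪ spectrum ℂ (leadingBlock k α β η)) ∧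
    ∀ ev : Fin k → ℝ → ℂ, IsEigenvalueTraces (kToeplitzSymbol k α β η) ev →
      sigmaWind (kToeplitzSymbol k α β η) = sigmaWindTraces (kToeplitzSymbol k α β η) ev := by
  refine ⟨⟨Set.union_subset (sigmaDet_subset_spectrum k α β η)
    (sigmaWind_subset_spectrum k α β η), fun lam hlam => ?_⟩,
    fun ev hev => sigmaWind_eq_sigmaWindTraces α β η ev hev⟩
  by_contra hn
  obtain ⟨hn, hB⟩ := not_or.1 hn
  obtain ⟨hdet, hw⟩ := not_or.1 hn
  exact hw ((mem_spectrum_kToeplitz_iff hB hdet).1 hlam)
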